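/- Let $X$ be a real Banach space. Write $\ell^2$ for the real Hilbert space of square-summable sequences indexed by $\mathbb N$, $\ell^2_k$ for $\mathbb R^k$ with the Euclidean norm, and $\ell^2(X)$, $\ell^2_k(X)$ for the spaces of square-summable sequences, respectively $k$-tuples, in $X$, with norm $\|(x_i)\|=(\sum_i\|x_i\|^2)^{1/2}$. For $k\in\mathbb N$ put $$e_k(X)=\sup\{\|u\otimes \mathrm{Id}_X\|_{\ell^2(X)\to\ell^2(X)} \;:\; u\colon\ell^2\to\ell^2 \text{ linear},\ \|u\|=1,\ \operatorname{rank}u=k\},$$ $$d_k(X)=\sup\{d(E,\ell^2_{\dim E}) \;:\; E\subset X \text{ a linear subspace},\ \dim E\le k\},$$ where $d(E,F)=\inf\{\|T\|\,\|T^{-1}\| : T\colon E\to F \text{ an isomorphism}\}$ is the Banach-Mazur distance; all suprema are taken in $[0,\infty]$. Then for every $k\in\mathbb N$, $$e_k(X)\le 2\sup_{a\colon\ell^2_k\to\ell^2_k,\ \|a\|\le 1}\|a\otimes \mathrm{Id}_X\|_{\ell^2_k(X)\to\ell^2_k(X)}.$$ In particular, $e_k(X)\le 2\,d_k(X)$ for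 all $k\in\mathbb N$. -/

import Mathlib

open scoped ENNReal TensorProduct

noncomputable section

/-- The space `ℓ²(ι; X)` of square-summable families in `X` with its usual norm. Here `ℓ²` is
`EllTwo ℕ ℝ`, `ℓ²_k` is `EllTwo (Fin k) ℝ`, `ℓ²(X)` is `EllTwo ℕ X` and `ℓ²_k(X)` is
`EllTwo (Fin k) X`. -/
abbrev EllTwo (ι : Type*) (X : Type*) [NormedAddCommGroup X] : Type _ :=
  lp (fun _ : ι => X) 2

/-- The elementary tensor `a ⊗ x` seen as the family `(a i • x)_i` in `ℓ²(ι; X)`. -/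
def elemTensor {ι X : Type*} [NormedAddCommGroup X] [NormedSpace ℝ X]
    (a : EllTwo ι ℝ) (x : X) : EllTwo ι X :=
  ⟨fun i => a i • x, by
    have h := (lp.memℓp a).norm.const_mul ‖x‖
    refine Memℓp.mono' h fun i => ?_
    simp [norm_smul, mul_comm]⟩

/-- The canonical (injective) map `ℓ²(ι) ⊗ X → ℓ²(ι; X)` from the algebraic tensor product, sending
`a ⊗ x` to `(a i • x)_i`. Its range is dense. -/
def tensorToEllTwo (ι X : Type*) [NormedAddCommGroup X] [NormedSpace ℝ X] :
    EllTwo ι ℝ ⊗[ℝ] X →ₗ[ℝ] EllTwo ι X :=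
  TensorProduct.lift <| LinearMap.mk₂ ℝ elemTensor
    (fun a b x => Subtype.ext <| funext fun i => add_smul (a i) (b i) x)
    (fun c a x => Subtype.ext <| funext fun i => mul_smul c (a i) x)
    (fun a x y => Subtype.ext <| funext fun i => smul_add (a i) x y)
    (fun c a x => Subtype.ext <| funext fun i => smul_comm (a i) c x)

/-- The operator norm `‖u ⊗ Id_X‖` on `ℓ²(ι; X)`, with value `∞` if `u ⊗ Id_X` is not bounded.
It is computed on the dense subspace `ℓ²(ι) ⊗ X`, normed as a subspace of `ℓ²(ι; X)`. -/
def tensorIdNorm {ι : Type*} (X : Type*) [NormedAddCommGroup X] [NormedSpace ℝ X]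
    (u : EllTwo ι ℝ →L[ℝ] EllTwo ι ℝ) : ℝ≥0∞ :=
  ⨆ (z : EllTwo ι ℝ ⊗[ℝ] X) (_ : ‖tensorToEllTwo ι X z‖ ≤ 1),
    ‖tensorToEllTwo ι X (LinearMap.rTensor X (u : EllTwo ι ℝ →ₗ[ℝ] EllTwo ι ℝ) z)‖ₑ

/-- The relative Euclidean factorization constant `e_k(X)`: the supremum of `‖u ⊗ Id_X‖` on
`ℓ²(X)` over the linear maps `u : ℓ² → ℓ²` of norm `1` and rank `k`. -/
def relEuclideanConst (k : ℕ) (X : Type*) [NormedAddCommGroup X] [NormedSpace ℝ X] : ℝ≥0∞ :=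
  ⨆ (u : EllTwo ℕ ℝ →L[ℝ] EllTwo ℕ ℝ) (_ : ‖u‖ = 1)
    (_ : LinearMap.rank (u : EllTwo ℕ ℝ →ₗ[ℝ] EllTwo ℕ ℝ) = (k : Cardinal)), tensorIdNorm X u

/-- The Banach-Mazur distance: the infimum of `‖T‖ ‖T⁻¹‖` over all isomorphisms `T : E → F`
(`∞` if there is none). -/
def banachMazurDist (E F : Type*) [NormedAddCommGroup E] [NormedSpace ℝ E]
    [NormedAddCommGroup F] [NormedSpace ℝ F] : ℝ≥0∞ :=
  ⨅ T : E ≃L[ℝ] F, ‖(T : E →L[ℝ] F)‖ₑ * ‖(T.symm : F →L[ℝ] E)‖ₑ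

/-- `d_k(X)`: the supremum of the Banach-Mazur distances `d(E, ℓ²_{dim E})` over the linear
subspaces `E` of `X` of dimension at most `k`. -/
def euclideanDistConst (k : ℕ) (X : Type*) [NormedAddCommGroup X] [NormedSpace ℝ X] : ℝ≥0∞ :=
  ⨆ (E : Submodule ℝ X) (_ : FiniteDimensional ℝ E) (_ : Module.finrank ℝ E ≤ k),
    banachMazurDist E (EllTwo (Fin (Module.finrank ℝ E)) ℝ)

end

/-! An operator `u` of rank `k` factors through its range `R`, a `k`-dimensional Hilbert space: its
matrix entries are `⟪f n, c i⟫`, where `f n` is the projection of the `n`-th unit vector onto `R`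
and `c i` is the image of the `i`-th one. Both families are Bessel when `‖u‖ ≤ 1`. The task is to
replace them by orthonormal bases of `R`, since the Gram matrix of two such bases is a contraction
of `ℓ²_k`.

The replacement is `IsBesselFamily.exists_orthonormal_sum_norm_sq_le`, which costs a factor 2 on
squared norms. It rests on an averaging induction over the dimension,
`IsParsevalFamily.exists_orthonormal_of_functionals`. Applied to `f` directly and to `c` by duality
(`sum_norm_sq_le_of_orthonormal_bound`), it loses 4 on squares, hence 2 on norms.

The bound by `d_k(X)` follows since `k` vectors of `X` span a space of dimension at most `k`, and on
Hilbert-valued tuples `a ⊗ Id` has norm at most `‖a‖`. -/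

section Frames

open scoped RealInnerProductSpace

universe v

variable {ι : Type*} [Fintype ι]

/-! ### Parseval families and extraction of orthonormal bases -/

/-- A finite family of vectors satisfying Parseval's identity. -/
def IsParsevalFamily {H : Type*} [NormedAddCommGroup H] [InnerProductSpace ℝ H]
    (p : ι → H) : Prop :=
  ∀ r, ∑ i, ⟪p i, r⟫ ^ 2 = ‖r‖ ^ 2

namespace IsParsevalFamily

variable {H : Type*} [NormedAddCommGroup H] [InnerProductSpace ℝ H] {p : ι → H}

theorem sum_inner_mul_inner (hp : IsParsevalFamily p) (x y : H) :
    ∑ i, ⟪p i, x⟫ * ⟪p i, y⟫ = ⟪x, y⟫ := by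
  have h := hp (x + y)
  have hx := hp x
  have hy := hp y
  have e : ∑ i, ⟪p i, x + y⟫ ^ 2
      = ∑ i, ⟪p i, x⟫ ^ 2 + 2 * ∑ i, ⟪p i, x⟫ * ⟪p i, y⟫ + ∑ i, ⟪p i, y⟫ ^ 2 := by
    rw [Finset.mul_sum, ← Finset.sum_add_distrib, ← Finset.sum_add_distrib]
    refine Finset.sum_congr rfl fun i _ => ?_
    rw [inner_add_right]; ring
  rw [e, hx, hy, norm_add_sq_real] at h
  linarith

theorem sum_inner_smul (hp : IsParsevalFamily p) (x : H) : ∑ i, ⟪p i, x⟫ • p i = x := by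
  refine ext_inner_right ℝ fun y => ?_
  rw [sum_inner, ← hp.sum_inner_mul_inner x y]
  simp [real_inner_smul_left]

theorem sum_norm_sq [FiniteDimensional ℝ H] (hp : IsParsevalFamily p) :
    ∑ i, ‖p i‖ ^ 2 = Module.finrank ℝ H := by
  let e := stdOrthonormalBasis ℝ H
  have h : ∀ i, ‖p i‖ ^ 2 = ∑ j, ⟪p i, e j⟫ ^ 2 := fun i => by
    rw [← e.sum_sq_norm_inner_left (p i)]
    simp
  simp_rw [h]
  rw [Finset.sum_comm]
  simp_rw [hp _]
  simp

theorem orthogonalProjectionOnto (hp : IsParsevalFamily p) (K : Submodule ℝ H)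
    [K.HasOrthogonalProjection] : IsParsevalFamily fun i => K.orthogonalProjectionOnto (p i) := by
  intro r
  have := hp (r : H)
  simpa [Submodule.inner_orthogonalProjectionOnto_eq_of_mem_left] using this

end IsParsevalFamily

/-- Induction on the dimension: split off a normalised `p i` and project the family onto its
orthogonal complement, where it stays Parseval. Fixed functionals `g` and weights `s` stand in for
norms so that the trace `∑ s i * g i (p i)` changes linearly and can be averaged over `i`. -/
theorem IsParsevalFamily.exists_orthonormal_of_functionals (m : ℕ) :
    ∀ (H : Type v) [NormedAddCommGroup H] [InnerProductSpace ℝ H] [FiniteDimensional ℝ H]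
      (_ : Module.finrank ℝ H = m) (p : ι → H) (_ : IsParsevalFamily p)
      (g : ι → H →ₗ[ℝ] ℝ) (s : ι → ℝ),
      ∃ b : Fin m → H, Orthonormal ℝ b ∧ ∃ c : Fin m → ι,
        ((m : ℝ) + 1) / (2 * m) * (∑ i, s i * g i (p i)) ^ 2 ≤
          (∑ i, s i ^ 2) * ∑ j, (g (c j) (b j)) ^ 2 := by
  induction m with
  | zero =>
    intro H _ _ _ _ p _ g s
    exact ⟨Fin.elim0, ⟨fun j => j.elim0, fun j => j.elim0⟩, Fin.elim0, by simp⟩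
  | succ m ih =>
    intro H _ _ _ hdim p hp g s
    set S := ∑ i, s i ^ 2 with hS
    set t := ∑ i, s i * g i (p i) with ht
    have hw : ∑ i, ‖p i‖ ^ 2 = (m : ℝ) + 1 := by rw [hp.sum_norm_sq, hdim]; push_cast; ring
    -- `q i` is the value at `p i` of the quadratic form `x ↦ ∑ l, s l * g l x * ⟪x, p l⟫`
    set q : ι → ℝ := fun i => ∑ l, s l * g l (p i) * ⟪p i, p l⟫ with hq
    have hqsum : ∑ i, q i = t := by
      simp only [hq]
      rw [Finset.sum_comm]
      refine Finset.sum_congr rfl fun l _ => ?_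
      conv_rhs => rw [← hp.sum_inner_smul (p l)]
      rw [map_sum, Finset.mul_sum]
      refine Finset.sum_congr rfl fun i _ => ?_
      rw [map_smul, smul_eq_mul]; ring
    have hgain : t ^ 2 ≤ S * ∑ i, g i (p i) ^ 2 := Finset.sum_mul_sq_le_sq_mul_sq _ _ _
    -- For `m = 0` division by zero gives `α = 0`, harmless because `hrec` multiplies it by `m ^ 2`.
    set α : ℝ := ((m : ℝ) + 1) / (2 * m) with hα
    have hα0 : 0 ≤ α := by positivity
    set α' : ℝ := (((m + 1 : ℕ) : ℝ) + 1) / (2 * ((m + 1 : ℕ) : ℝ)) with hα'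
    have hrec : ((m : ℝ) + 1) * α' = 1 + α * (m ^ 2 / (m + 1)) := by
      rw [hα, hα']; push_cast
      rcases Nat.eq_zero_or_pos m with rfl | h
      · norm_num
      · have : (0 : ℝ) < m := by exact_mod_cast h
        field_simp; ring
    -- The mean, with weights `‖p i‖ ^ 2 / (m + 1)`, of the trace left after removing `p i`. The
    -- square of that trace is bounded below by its tangent at `d`.
    set d : ℝ := m * t / (m + 1) with hd
    -- Summed over all `i` the inequality holds by `hgain` and `hrec`, and terms with `p i = 0`
    -- vanish on both sides, so some nonzero `p i` satisfies it.
    have hex : ∃ i, p i ≠ 0 ∧ ‖p i‖ ^ 2 * (α' * t ^ 2) ≤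
        S * g i (p i) ^ 2 + α * (2 * d * (‖p i‖ ^ 2 * t - q i) - ‖p i‖ ^ 2 * d ^ 2) := by
      by_contra! hcon
      have hle : ∀ i, S * g i (p i) ^ 2 + α * (2 * d * (‖p i‖ ^ 2 * t - q i) - ‖p i‖ ^ 2 * d ^ 2)
          ≤ ‖p i‖ ^ 2 * (α' * t ^ 2) := fun i => by
        by_cases h : p i = 0
        · simp [h, hq]
        · exact (hcon i h).le
      obtain ⟨i₀, hi₀⟩ : ∃ i, p i ≠ 0 := by
        by_contra! h
        simp [h] at hw
        linarith
      have hlt := Finset.sum_lt_sum (s := Finset.univ) (fun i _ => hle i)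
        ⟨i₀, Finset.mem_univ _, hcon i₀ hi₀⟩
      have e1 : ∑ i, (S * g i (p i) ^ 2
          + α * (2 * d * (‖p i‖ ^ 2 * t - q i) - ‖p i‖ ^ 2 * d ^ 2))
          = S * ∑ i, g i (p i) ^ 2 + α * (2 * d * (((m : ℝ) + 1) * t - t) - (m + 1) * d ^ 2) := by
        rw [Finset.sum_add_distrib, ← Finset.mul_sum, ← Finset.mul_sum, Finset.sum_sub_distrib,
          ← Finset.mul_sum, Finset.sum_sub_distrib, ← Finset.sum_mul, ← Finset.sum_mul, hw, hqsum]
      rw [e1, ← Finset.sum_mul, hw, ← mul_assoc, hrec] at hlt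
      have e2 : 2 * d * (((m : ℝ) + 1) * t - t) - (m + 1) * d ^ 2 = m ^ 2 / (m + 1) * t ^ 2 := by
        rw [hd]; field_simp; ring
      rw [e2] at hlt
      nlinarith
    obtain ⟨i, hi0, hi⟩ := hex
    have hn : 0 < ‖p i‖ := norm_pos_iff.mpr hi0
    set e : H := ‖p i‖⁻¹ • p i with he
    have hnorm : ‖e‖ = 1 := by rw [he, norm_smul, norm_inv, norm_norm, inv_mul_cancel₀ hn.ne']
    have he0 : e ≠ 0 := fun h => by simp [h] at hnorm
    set K : Submodule ℝ H := (ℝ ∙ e)ᗮ with hK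
    have hdimK : Module.finrank ℝ K = m := by
      have : Fact (Module.finrank ℝ H = m + 1) := ⟨hdim⟩
      exact Submodule.finrank_orthogonal_span_singleton he0
    obtain ⟨b, hb, c, hc⟩ := ih K hdimK _ (hp.orthogonalProjectionOnto K)
      (fun l => (g l).comp K.subtype) s
    have hproj : ∀ x : H, ((K.orthogonalProjectionOnto x : K) : H) = x - ⟪e, x⟫ • e := fun x => by
      have h := Submodule.starProjection_orthogonal_val (K := (ℝ ∙ e)) x
      rw [Submodule.starProjection_unit_singleton ℝ hnorm] at h
      exact h
    have ht' : ∑ l, s l * ((g l).comp K.subtype) (K.orthogonalProjectionOnto (p l))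
        = t - (‖p i‖ ^ 2)⁻¹ * q i := by
      simp only [LinearMap.comp_apply, Submodule.subtype_apply, hproj, ht, hq]
      rw [Finset.mul_sum, ← Finset.sum_sub_distrib]
      refine Finset.sum_congr rfl fun l _ => ?_
      rw [map_sub, map_smul, he, map_smul, real_inner_smul_left, smul_eq_mul, smul_eq_mul]
      field_simp
    refine ⟨Fin.cons e fun j => (b j : H), ?_, Fin.cons i c, ?_⟩
    · rw [orthonormal_iff_ite]
      have hbe : ∀ j, ⟪e, (b j : H)⟫ = 0 := fun j =>
        Submodule.mem_orthogonal_singleton_iff_inner_right.mp (b j).2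
      have hbb := orthonormal_iff_ite.mp hb
      intro j l
      refine Fin.cases ?_ (fun j => ?_) j <;> refine Fin.cases ?_ (fun l => ?_) l
      · simp [hnorm]
      · simp [hbe, (Fin.succ_ne_zero l).symm]
      · simp [real_inner_comm e, hbe]
      · simpa using hbb j l
    · rw [Fin.sum_univ_succ]
      simp only [Fin.cons_zero, Fin.cons_succ]
      rw [ht'] at hc
      simp only [LinearMap.comp_apply, Submodule.subtype_apply] at hc
      have hge : g i e ^ 2 = (‖p i‖ ^ 2)⁻¹ * g i (p i) ^ 2 := by
        rw [he, map_smul, smul_eq_mul]; field_simp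
      set t' := t - (‖p i‖ ^ 2)⁻¹ * q i with ht'd
      have hlin : α * (2 * d * t' - d ^ 2) ≤ α * t' ^ 2 :=
        mul_le_mul_of_nonneg_left (by nlinarith [sq_nonneg (t' - d)]) hα0
      have hi' : α' * t ^ 2 ≤ S * g i e ^ 2 + α * (2 * d * t' - d ^ 2) := by
        have hn2 : 0 < ‖p i‖ ^ 2 := by positivity
        refine le_of_mul_le_mul_left (hi.trans_eq ?_) hn2
        rw [hge, ht'd]
        field_simp
      rw [mul_add]
      linarith

/-! ### Bessel families and the two-sided reduction to orthonormal bases -/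

/-- A finite family of vectors satisfying Bessel's inequality. -/
def IsBesselFamily {H : Type*} [NormedAddCommGroup H] [InnerProductSpace ℝ H]
    (a : ι → H) : Prop :=
  ∀ r, ∑ i, ⟪a i, r⟫ ^ 2 ≤ ‖r‖ ^ 2

/-- The defect `B = Id - ∑ a i ⊗ a i` is positive; its eigenvectors scaled by the roots of the
eigenvalues supply the missing part. -/
theorem IsBesselFamily.exists_isParsevalFamily_sumElim {H : Type*} [NormedAddCommGroup H]
    [InnerProductSpace ℝ H] [FiniteDimensional ℝ H] {a : ι → H} (ha : IsBesselFamily a) :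
    ∃ a' : Fin (Module.finrank ℝ H) → H, IsParsevalFamily (Sum.elim a a') := by
  set B : H →ₗ[ℝ] H := LinearMap.id - ∑ i, (innerₛₗ ℝ (a i)).smulRight (a i) with hB
  have hBapp : ∀ x y, ⟪B x, y⟫ = ⟪x, y⟫ - ∑ i, ⟪a i, x⟫ * ⟪a i, y⟫ := fun x y => by
    simp [hB, inner_sub_left, sum_inner, real_inner_smul_left]
  have hsymm : B.IsSymmetric := fun x y => by
    rw [real_inner_comm (B y), hBapp, hBapp, real_inner_comm]
    simp [mul_comm]
  set v := hsymm.eigenvectorBasis rfl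
  set μ := hsymm.eigenvalues rfl
  have hv : ∀ l, B (v l) = μ l • v l := fun l => hsymm.apply_eigenvectorBasis rfl l
  have hμ : ∀ l, 0 ≤ μ l := fun l => by
    have h := hBapp (v l) (v l)
    rw [hv, real_inner_smul_left, real_inner_self_eq_norm_sq, v.norm_eq_one] at h
    have h' := ha (v l)
    simp only [sq, v.norm_eq_one] at h h'
    linarith
  refine ⟨fun l => √(μ l) • v l, fun r => ?_⟩
  have h1 : ⟪B r, r⟫ = ∑ l, ⟪√(μ l) • v l, r⟫ ^ 2 := by
    rw [← v.sum_inner_mul_inner (B r) r]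
    refine Finset.sum_congr rfl fun l _ => ?_
    rw [hsymm, hv, real_inner_smul_right, real_inner_smul_left, mul_pow, Real.sq_sqrt (hμ l),
      real_inner_comm r]
    ring
  rw [hBapp, real_inner_self_eq_norm_sq] at h1
  simp only [Fintype.sum_sum_type, Sum.elim_inl, Sum.elim_inr, ← h1]
  simp [sq]

/-- The square of the 2-summing norm of a map on a `k`-dimensional Hilbert space is at most twice
the square of the one computed with orthonormal bases. -/
theorem IsBesselFamily.exists_orthonormal_sum_norm_sq_le {H : Type*} [NormedAddCommGroup H]
    [InnerProductSpace ℝ H] [FiniteDimensional ℝ H] {k : ℕ} (hk : Module.finrank ℝ H = k)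
    {Y : Type*} [NormedAddCommGroup Y] [NormedSpace ℝ Y] (V : H →ₗ[ℝ] Y) {a : ι → H}
    (ha : IsBesselFamily a) :
    ∃ b : Fin k → H, Orthonormal ℝ b ∧ ∑ i, ‖V (a i)‖ ^ 2 ≤ 2 * ∑ j, ‖V (b j)‖ ^ 2 := by
  obtain ⟨a', ha'⟩ := ha.exists_isParsevalFamily_sumElim
  choose φ hφ1 hφ2 using fun y : Y => exists_dual_vector'' ℝ y
  -- With norming functionals and weights `‖V (a i)‖`, zero on the added vectors, both the trace and
  -- the sum of squared weights equal `τ`.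
  obtain ⟨b, hb, c, hc⟩ := IsParsevalFamily.exists_orthonormal_of_functionals k H hk _ ha'
    (fun i => (φ (V (Sum.elim a a' i)) : Y →ₗ[ℝ] ℝ).comp V) (Sum.elim (fun i => ‖V (a i)‖) 0)
  refine ⟨b, hb, ?_⟩
  set τ := ∑ i, ‖V (a i)‖ ^ 2 with hτ
  have hτ0 : 0 ≤ τ := by positivity
  have hgb : ∀ j, (((φ (V (Sum.elim a a' (c j))) : Y →ₗ[ℝ] ℝ).comp V) (b j)) ^ 2
      ≤ ‖V (b j)‖ ^ 2 := fun j => by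
    rw [← sq_abs, ← Real.norm_eq_abs]
    refine pow_le_pow_left₀ (norm_nonneg _) ?_ 2
    exact ((φ _).le_of_opNorm_le (hφ1 _) _).trans_eq (one_mul _)
  have hsum : ∑ j, (((φ (V (Sum.elim a a' (c j))) : Y →ₗ[ℝ] ℝ).comp V) (b j)) ^ 2
      ≤ ∑ j, ‖V (b j)‖ ^ 2 := Finset.sum_le_sum fun j _ => hgb j
  have e1 : ∑ i, Sum.elim (fun i => ‖V (a i)‖) 0 i *
      ((φ (V (Sum.elim a a' i)) : Y →ₗ[ℝ] ℝ).comp V) (Sum.elim a a' i) = τ := by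
    simp only [Fintype.sum_sum_type, Sum.elim_inl, Sum.elim_inr, LinearMap.comp_apply,
      ContinuousLinearMap.coe_coe, hφ2, hτ]
    simp [sq]
  have e2 : ∑ i : ι ⊕ Fin (Module.finrank ℝ H), Sum.elim (fun i => ‖V (a i)‖) (0 : Fin _ → ℝ) i ^ 2 = τ := by
    simp [Fintype.sum_sum_type, hτ]
  rw [e1, e2] at hc
  have hc' := hc.trans (mul_le_mul_of_nonneg_left hsum hτ0)
  rcases hτ0.eq_or_lt with h0 | h0
  · rw [← h0]; positivity
  · rcases Nat.eq_zero_or_pos k with rfl | hk0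
    · have : Subsingleton H := Module.finrank_zero_iff.mp hk
      have h2 : τ = 0 := Finset.sum_eq_zero fun i _ => by simp [Subsingleton.elim (a i) 0]
      exact absurd h2 h0.ne'
    · have hk1 : (0 : ℝ) < k := by exact_mod_cast hk0
      have hα : (1 : ℝ) / 2 ≤ ((k : ℝ) + 1) / (2 * k) := by
        rw [div_le_div_iff₀ two_pos (by positivity)]; linarith
      have h3 := (mul_le_mul_of_nonneg_right hα (sq_nonneg τ)).trans hc'
      rw [sq, ← mul_assoc, mul_comm _ τ] at h3
      have h4 : τ * (1 / 2 * τ) ≤ τ * ∑ j, ‖V (b j)‖ ^ 2 := by linarith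
      have := le_of_mul_le_mul_left h4 h0
      linarith

/-- The norm of `φ` need not be attained, hence the loss `θ`. -/
theorem StrongDual.exists_norm_le_mul_sq_le {X : Type*} [NormedAddCommGroup X] [NormedSpace ℝ X]
    (φ : StrongDual ℝ X) {θ : ℝ} (hθ : θ < 1) : ∃ x, ‖x‖ ≤ ‖φ‖ ∧ θ * ‖φ‖ ^ 2 ≤ φ x := by
  rcases (norm_nonneg φ).eq_or_lt with h0 | h0
  · exact ⟨0, by simp, by simp [← h0]⟩
  · obtain ⟨x, hx, hx'⟩ := φ.exists_lt_apply_of_lt_opNorm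
      (show θ * ‖φ‖ < ‖φ‖ by nlinarith)
    have key : ∀ y : X, ‖y‖ < 1 → θ * ‖φ‖ < φ y → ∃ x, ‖x‖ ≤ ‖φ‖ ∧ θ * ‖φ‖ ^ 2 ≤ φ x := by
      intro y hy hy'
      refine ⟨‖φ‖ • y, ?_, ?_⟩
      · rw [norm_smul, norm_norm]; nlinarith
      · rw [map_smul, smul_eq_mul]; nlinarith
    rw [Real.norm_eq_abs] at hx'
    rcases lt_abs.mp hx' with h | h
    · exact key x hx h
    · exact key (-x) (by rwa [norm_neg]) (by rwa [map_neg])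

theorem sum_norm_sq_le_of_orthonormal_bound {H : Type*} [NormedAddCommGroup H]
    [InnerProductSpace ℝ H] [FiniteDimensional ℝ H] {k : ℕ} (hk : Module.finrank ℝ H = k)
    {X : Type*} [NormedAddCommGroup X] [NormedSpace ℝ X] {C : ℝ} (hC0 : 0 ≤ C)
    (hC : ∀ b b' : Fin k → H, Orthonormal ℝ b → Orthonormal ℝ b' → ∀ x : Fin k → X,
      ∑ j, ‖∑ l, ⟪b j, b' l⟫ • x l‖ ^ 2 ≤ C * ∑ l, ‖x l‖ ^ 2)
    {κ : Type*} [Fintype κ] {f : ι → H} {c : κ → H} (hf : IsBesselFamily f)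
    (hc : IsBesselFamily c) (x : κ → X) :
    ∑ n, ‖∑ i, ⟪f n, c i⟫ • x i‖ ^ 2 ≤ 4 * C * ∑ i, ‖x i‖ ^ 2 := by
  set T : H →ₗ[ℝ] X := ∑ i, (innerₛₗ ℝ (c i)).smulRight (x i) with hT
  have hTapp : ∀ r, T r = ∑ i, ⟪r, c i⟫ • x i := fun r => by
    simp [hT, real_inner_comm]
  obtain ⟨b, hb, hfb⟩ := hf.exists_orthonormal_sum_norm_sq_le hk T
  simp only [hTapp] at hfb
  refine hfb.trans ?_
  set y : Fin k → X := fun j => ∑ i, ⟪b j, c i⟫ • x i with hy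
  set Q := ∑ j, ‖y j‖ ^ 2 with hQ
  have hQ0 : 0 ≤ Q := by positivity
  choose η hη1 hη2 using fun j => exists_dual_vector'' ℝ (y j)
  -- Duality moves the family `c` into the argument of a linear map, so the orthonormal replacement
  -- applies to it too.
  set V : H →ₗ[ℝ] StrongDual ℝ X := ∑ j, (innerₛₗ ℝ (b j)).smulRight (‖y j‖ • η j) with hV
  have hVapp : ∀ r z, V r z = ∑ j, ‖y j‖ * η j (⟪b j, r⟫ • z) := fun r z => by
    simp only [hV, LinearMap.sum_apply, LinearMap.smulRight_apply, innerₛₗ_apply_apply,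
      _root_.sum_apply, _root_.smul_apply, smul_eq_mul, map_smul]
    exact Finset.sum_congr rfl fun j _ => by ring
  have hQV : Q = ∑ i, V (c i) (x i) := by
    simp_rw [hVapp]
    rw [Finset.sum_comm]
    refine Finset.sum_congr rfl fun j _ => ?_
    rw [← Finset.mul_sum, ← map_sum, sq]
    exact congrArg _ (hη2 j).symm
  obtain ⟨b', hb', hcb⟩ := hc.exists_orthonormal_sum_norm_sq_le hk V
  set N := ∑ l, ‖V (b' l)‖ ^ 2 with hN
  have hN0 : 0 ≤ N := by positivity
  have hθ : ∀ θ : ℝ, 0 ≤ θ → θ < 1 → θ ^ 2 * N ≤ C * Q := by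
    intro θ h0 h1
    choose z hz1 hz2 using fun l => (V (b' l)).exists_norm_le_mul_sq_le h1
    have hzN : ∑ l, ‖z l‖ ^ 2 ≤ N :=
      Finset.sum_le_sum fun l _ => pow_le_pow_left₀ (norm_nonneg _) (hz1 l) 2
    have hlow : θ * N ≤ ∑ l, V (b' l) (z l) := by
      rw [hN, Finset.mul_sum]
      exact Finset.sum_le_sum fun l _ => hz2 l
    set w : Fin k → X := fun j => ∑ l, ⟪b j, b' l⟫ • z l with hw
    have hup : ∑ l, V (b' l) (z l) ≤ ∑ j, ‖y j‖ * ‖w j‖ := by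
      simp_rw [hVapp]
      rw [Finset.sum_comm]
      refine Finset.sum_le_sum fun j _ => ?_
      rw [← Finset.mul_sum, ← map_sum]
      refine mul_le_mul_of_nonneg_left ?_ (norm_nonneg _)
      exact (le_abs_self _).trans (((η j).le_of_opNorm_le (hη1 j) _).trans_eq (one_mul _))
    have hcs : (∑ j, ‖y j‖ * ‖w j‖) ^ 2 ≤ Q * (C * N) :=
      (Finset.sum_mul_sq_le_sq_mul_sq _ _ _).trans
        (mul_le_mul_of_nonneg_left ((hC b b' hb hb' z).trans
          (mul_le_mul_of_nonneg_left hzN hC0)) hQ0)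
    have hfin : (θ * N) ^ 2 ≤ Q * (C * N) :=
      (pow_le_pow_left₀ (by positivity) (hlow.trans hup) 2).trans hcs
    rcases hN0.eq_or_lt with h | h
    · rw [← h, mul_zero]; positivity
    · refine le_of_mul_le_mul_right ?_ h
      linarith
  -- Let `θ` tend to 1.
  have hNQ : N ≤ C * Q := by
    have hlim : Filter.Tendsto (fun θ : ℝ => θ ^ 2 * N) (nhdsWithin 1 (Set.Iio 1))
        (nhds (1 ^ 2 * N)) :=
      ((continuous_pow 2).mul continuous_const).continuousAt.tendsto.mono_left nhdsWithin_le_nhds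
    rw [one_pow, one_mul] at hlim
    refine le_of_tendsto hlim ?_
    filter_upwards [Ioo_mem_nhdsLT (show (0 : ℝ) < 1 by norm_num)] with θ hθ'
    exact hθ θ hθ'.1.le hθ'.2
  have hcs : Q ^ 2 ≤ (∑ i, ‖V (c i)‖ ^ 2) * ∑ i, ‖x i‖ ^ 2 := by
    refine le_trans (pow_le_pow_left₀ hQ0 ?_ 2) (Finset.sum_mul_sq_le_sq_mul_sq _ _ _)
    rw [hQV]
    exact Finset.sum_le_sum fun i _ => (le_abs_self _).trans ((V (c i)).le_opNorm (x i))
  have hx0 : 0 ≤ ∑ i, ‖x i‖ ^ 2 := by positivity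
  have hQ2 : Q * Q ≤ Q * (2 * C * ∑ i, ‖x i‖ ^ 2) := by
    have := hcs.trans (mul_le_mul_of_nonneg_right
      (hcb.trans (mul_le_mul_of_nonneg_left hNQ two_pos.le)) hx0)
    linarith
  rcases hQ0.eq_or_lt with h | h
  · rw [← h, mul_zero]; positivity
  · have := le_of_mul_le_mul_left hQ2 h
    linarith

end Frames

/-! ### Matrix description of `u ⊗ Id` and the rank `k` bound -/

section EllTwo

open scoped RealInnerProductSpace

variable {ι X : Type*} [NormedAddCommGroup X]

namespace EllTwo

theorem hasSum_norm_sq (x : EllTwo ι X) : HasSum (fun i => ‖x i‖ ^ 2) (‖x‖ ^ 2) := by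
  simpa using lp.hasSum_norm (p := 2) (by simp) x

theorem sum_norm_sq_le (x : EllTwo ι X) (s : Finset ι) : ∑ i ∈ s, ‖x i‖ ^ 2 ≤ ‖x‖ ^ 2 :=
  sum_le_hasSum s (fun _ _ => by positivity) x.hasSum_norm_sq

theorem norm_sq_eq_sum [Fintype ι] (x : EllTwo ι X) : ‖x‖ ^ 2 = ∑ i, ‖x i‖ ^ 2 :=
  x.hasSum_norm_sq.unique (hasSum_fintype _)

theorem norm_le_of_forall_sum_le {x : EllTwo ι X} {C : ℝ} (hC : 0 ≤ C)
    (h : ∀ s : Finset ι, ∑ i ∈ s, ‖x i‖ ^ 2 ≤ C ^ 2) : ‖x‖ ≤ C :=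
  (sq_le_sq₀ (norm_nonneg _) hC).mp (hasSum_le_of_sum_le x.hasSum_norm_sq h)

/-- The elements of `ℓ²(ι; X)` for finite `ι`. -/
def ofFun [Finite ι] (x : ι → X) : EllTwo ι X := ⟨x, Memℓp.all x⟩

@[simp]
theorem ofFun_apply [Finite ι] (x : ι → X) (i : ι) : ofFun x i = x i := rfl

/-- The unit vectors of `ℓ²(ι)`. -/
def unit [DecidableEq ι] (i : ι) : EllTwo ι ℝ := lp.single 2 i 1

theorem unit_apply [DecidableEq ι] (i j : ι) : unit i j = if j = i then (1 : ℝ) else 0 := by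
  simp [unit, lp.single_apply, Pi.single_apply]

theorem inner_unit_left [DecidableEq ι] (i : ι) (v : EllTwo ι ℝ) : ⟪unit i, v⟫ = v i := by
  simp [unit, lp.inner_single_left]

theorem hasSum_smul_unit [DecidableEq ι] (v : EllTwo ι ℝ) : HasSum (fun i => v i • unit i) v := by
  convert lp.hasSum_single (p := 2) (by simp) v using 2 with i
  rw [unit, ← lp.single_smul, smul_eq_mul, mul_one]

end EllTwo

variable [NormedSpace ℝ X]

theorem tensorToEllTwo_tmul_apply (v : EllTwo ι ℝ) (x : X) (i : ι) :
    tensorToEllTwo ι X (v ⊗ₜ x) i = v i • x := rfl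

/-- The matrix form of `u ⊗ Id_X`. -/
theorem hasSum_tensorToEllTwo_rTensor [DecidableEq ι] (u : EllTwo ι ℝ →L[ℝ] EllTwo ι ℝ)
    (z : EllTwo ι ℝ ⊗[ℝ] X) (n : ι) :
    HasSum (fun i => u (EllTwo.unit i) n • tensorToEllTwo ι X z i)
      (tensorToEllTwo ι X (LinearMap.rTensor X (u : EllTwo ι ℝ →ₗ[ℝ] EllTwo ι ℝ) z) n) := by
  induction z with
  | zero => simp
  | tmul v x =>
    have h := ((EllTwo.hasSum_smul_unit v).mapL u).mapL (lp.evalCLM ℝ (fun _ : ι => ℝ) 2 n)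
    have h' := h.smul_const x
    rw [LinearMap.rTensor_tmul, tensorToEllTwo_tmul_apply]
    convert h' using 2 with i
    · simp [tensorToEllTwo_tmul_apply, smul_smul, mul_comm, lp.evalCLM]
    · rfl
  | add z w hz hw =>
    simp only [map_add, lp.coeFn_add, Pi.add_apply, smul_add]
    exact hz.add hw

theorem tensorToEllTwo_rTensor_apply [Fintype ι] [DecidableEq ι]
    (u : EllTwo ι ℝ →L[ℝ] EllTwo ι ℝ) (z : EllTwo ι ℝ ⊗[ℝ] X) (n : ι) :
    tensorToEllTwo ι X (LinearMap.rTensor X (u : EllTwo ι ℝ →ₗ[ℝ] EllTwo ι ℝ) z) n =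
      ∑ i, u (EllTwo.unit i) n • tensorToEllTwo ι X z i :=
  (hasSum_tensorToEllTwo_rTensor u z n).unique (hasSum_fintype _)

theorem exists_tensorToEllTwo_eq [Fintype ι] (x : EllTwo ι X) :
    ∃ z, tensorToEllTwo ι X z = x := by
  classical
  refine ⟨∑ i, EllTwo.unit i ⊗ₜ x i, ?_⟩
  ext j
  rw [map_sum, lp.coeFn_sum, Finset.sum_apply]
  simp [tensorToEllTwo_tmul_apply, EllTwo.unit_apply]

theorem norm_tensorToEllTwo_rTensor_le {u : EllTwo ι ℝ →L[ℝ] EllTwo ι ℝ} {d : ℝ} (hd : 0 ≤ d)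
    (hu : tensorIdNorm X u ≤ ENNReal.ofReal d) (z : EllTwo ι ℝ ⊗[ℝ] X) :
    ‖tensorToEllTwo ι X (LinearMap.rTensor X (u : EllTwo ι ℝ →ₗ[ℝ] EllTwo ι ℝ) z)‖ ≤
      d * ‖tensorToEllTwo ι X z‖ := by
  classical
  rcases (norm_nonneg (tensorToEllTwo ι X z)).eq_or_lt with h0 | h0
  · have hz : tensorToEllTwo ι X z = 0 := norm_eq_zero.mp h0.symm
    have : tensorToEllTwo ι X (LinearMap.rTensor X (u : EllTwo ι ℝ →ₗ[ℝ] EllTwo ι ℝ) z) = 0 := by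
      ext n
      refine (hasSum_tensorToEllTwo_rTensor u z n).unique ?_
      simp [hz]
    rw [this, norm_zero, ← h0, mul_zero]
  · set c := ‖tensorToEllTwo ι X z‖ with hc
    have hn : ‖tensorToEllTwo ι X (c⁻¹ • z)‖ ≤ 1 := by
      rw [map_smul, norm_smul, norm_inv, ← hc, Real.norm_of_nonneg h0.le, inv_mul_cancel₀ h0.ne']
    have h := (le_iSup₂ (f := fun (z : EllTwo ι ℝ ⊗[ℝ] X) (_ : ‖tensorToEllTwo ι X z‖ ≤ 1) =>
      ‖tensorToEllTwo ι X (LinearMap.rTensor X (u : EllTwo ι ℝ →ₗ[ℝ] EllTwo ι ℝ) z)‖ₑ)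
      (c⁻¹ • z) hn).trans hu
    rw [← ofReal_norm, ENNReal.ofReal_le_ofReal_iff hd, map_smul, map_smul, norm_smul,
      norm_inv, Real.norm_of_nonneg h0.le, inv_mul_le_iff₀ h0] at h
    linarith

/-- The operator on `ℓ²_k` whose matrix is formed by the inner products of two orthonormal
families. -/
noncomputable def crossGramCLM {k : ℕ} {H : Type*} [NormedAddCommGroup H] [InnerProductSpace ℝ H]
    (b b' : Fin k → H) (hb : Orthonormal ℝ b) (hb' : Orthonormal ℝ b') :
    EllTwo (Fin k) ℝ →L[ℝ] EllTwo (Fin k) ℝ :=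
  LinearMap.mkContinuous
    { toFun := fun v => EllTwo.ofFun fun j => ⟪b j, ∑ l, v l • b' l⟫
      map_add' := fun v w => by
        ext j
        simp [add_smul, Finset.sum_add_distrib, inner_add_right]
      map_smul' := fun r v => by
        ext j
        simp [mul_smul, ← Finset.smul_sum, real_inner_smul_right] } 1 fun v => by
    rw [one_mul, ← sq_le_sq₀ (norm_nonneg _) (norm_nonneg _), EllTwo.norm_sq_eq_sum,
      EllTwo.norm_sq_eq_sum]
    refine (hb.sum_inner_products_le (∑ l, v l • b' l) (s := Finset.univ)).trans_eq ?_
    rw [← real_inner_self_eq_norm_sq, hb'.inner_sum]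
    simp [sq]

theorem sum_norm_sq_sum_inner_smul_le {k : ℕ} {d : ℝ} (hd : 0 ≤ d)
    (hX : ∀ a : EllTwo (Fin k) ℝ →L[ℝ] EllTwo (Fin k) ℝ, ‖a‖ ≤ 1 →
      tensorIdNorm X a ≤ ENNReal.ofReal d)
    {H : Type*} [NormedAddCommGroup H] [InnerProductSpace ℝ H] {b b' : Fin k → H}
    (hb : Orthonormal ℝ b) (hb' : Orthonormal ℝ b') (x : Fin k → X) :
    ∑ j, ‖∑ l, ⟪b j, b' l⟫ • x l‖ ^ 2 ≤ d ^ 2 * ∑ l, ‖x l‖ ^ 2 := by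
  obtain ⟨z, hz⟩ := exists_tensorToEllTwo_eq (EllTwo.ofFun x)
  have ha : ‖crossGramCLM b b' hb hb'‖ ≤ 1 := LinearMap.mkContinuous_norm_le _ zero_le_one _
  have h := norm_tensorToEllTwo_rTensor_le hd (hX _ ha) z
  rw [← sq_le_sq₀ (norm_nonneg _) (by positivity), mul_pow, EllTwo.norm_sq_eq_sum,
    EllTwo.norm_sq_eq_sum, hz] at h
  have hentry : ∀ j l, crossGramCLM b b' hb hb' (EllTwo.unit l) j = ⟪b j, b' l⟫ := fun j l => by
    simp [crossGramCLM, EllTwo.unit_apply]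
  simpa only [tensorToEllTwo_rTensor_apply, hz, EllTwo.ofFun_apply, hentry] using h

theorem tensorIdNorm_le_of_rank_eq {k : ℕ} {d : ℝ} (hd : 0 ≤ d)
    (hX : ∀ a : EllTwo (Fin k) ℝ →L[ℝ] EllTwo (Fin k) ℝ, ‖a‖ ≤ 1 →
      tensorIdNorm X a ≤ ENNReal.ofReal d)
    {u : EllTwo ℕ ℝ →L[ℝ] EllTwo ℕ ℝ} (hu : ‖u‖ ≤ 1)
    (hrank : LinearMap.rank (u : EllTwo ℕ ℝ →ₗ[ℝ] EllTwo ℕ ℝ) = (k : Cardinal)) :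
    tensorIdNorm X u ≤ ENNReal.ofReal (2 * d) := by
  refine iSup₂_le fun z hz => ?_
  rw [← ofReal_norm]
  refine ENNReal.ofReal_le_ofReal (EllTwo.norm_le_of_forall_sum_le (by positivity) fun s => ?_)
  set R := LinearMap.range (u : EllTwo ℕ ℝ →ₗ[ℝ] EllTwo ℕ ℝ) with hR
  have hfin : FiniteDimensional ℝ R := Module.finite_of_rank_eq_nat hrank
  have hdim : Module.finrank ℝ R = k := Module.finrank_eq_of_rank_eq hrank
  set f : ℕ → R := fun n => R.orthogonalProjectionOnto (EllTwo.unit n) with hf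
  set c : ℕ → R := fun i => ⟨u (EllTwo.unit i), ⟨_, rfl⟩⟩ with hc
  have hfr : ∀ (n : ℕ) (r : R), ⟪f n, r⟫ = (r : EllTwo ℕ ℝ) n := fun n r => by
    rw [← EllTwo.inner_unit_left]
    exact Submodule.inner_orthogonalProjectionOnto_eq_of_mem_right r _
  have hfB : IsBesselFamily fun n : s => f n := fun r => by
    simp only [hfr]
    rw [Finset.sum_coe_sort s fun n => (r : EllTwo ℕ ℝ) n ^ 2]
    simpa using (r : EllTwo ℕ ℝ).sum_norm_sq_le s
  have hcB : ∀ t : Finset ℕ, IsBesselFamily fun i : t => c i := fun t r => by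
    have hcr : ∀ i, ⟪c i, r⟫ = (ContinuousLinearMap.adjoint u (r : EllTwo ℕ ℝ)) i := fun i => by
      rw [← EllTwo.inner_unit_left, ContinuousLinearMap.adjoint_inner_right]
      rfl
    simp only [hcr]
    rw [Finset.sum_coe_sort t fun i => (ContinuousLinearMap.adjoint u (r : EllTwo ℕ ℝ)) i ^ 2]
    have h1 := (ContinuousLinearMap.adjoint u (r : EllTwo ℕ ℝ)).sum_norm_sq_le t
    simp only [Real.norm_eq_abs, sq_abs] at h1
    refine h1.trans (pow_le_pow_left₀ (norm_nonneg _) ?_ 2)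
    refine (ContinuousLinearMap.le_of_opNorm_le _ (c := 1) ?_ _).trans_eq (one_mul _)
    rwa [LinearIsometryEquiv.norm_map]
  set x := tensorToEllTwo ℕ X z with hx
  -- Rows are cut to `s` and columns to `t`, since the Hilbert space lemma needs finite families;
  -- `t` then grows to all of `ℕ`.
  have hbound : ∀ t : Finset ℕ,
      ∑ n ∈ s, ‖∑ i ∈ t, u (EllTwo.unit i) n • x i‖ ^ 2 ≤ (2 * d) ^ 2 := fun t => by
    have h := sum_norm_sq_le_of_orthonormal_bound hdim (sq_nonneg d)
      (fun b b' hb hb' y => sum_norm_sq_sum_inner_smul_le hd hX hb hb' y) hfB (hcB t)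
      (fun i : t => x i)
    simp only [hfr, hc] at h
    rw [Finset.sum_coe_sort t fun i => ‖x i‖ ^ 2,
      Finset.sum_coe_sort s fun n => ‖∑ i : t, u (EllTwo.unit (i : ℕ)) n • x i‖ ^ 2] at h
    simp only [fun n => Finset.sum_coe_sort t fun i => u (EllTwo.unit i) n • x i] at h
    have hx1 : ∑ i ∈ t, ‖x i‖ ^ 2 ≤ 1 :=
      (x.sum_norm_sq_le t).trans (pow_le_one₀ (norm_nonneg _) hz)
    nlinarith [sq_nonneg d]
  have hlim := tendsto_finsetSum s fun n _ =>
    Filter.Tendsto.pow (Filter.Tendsto.norm (hasSum_tensorToEllTwo_rTensor u z n)) 2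
  exact le_of_tendsto hlim (Filter.Eventually.of_forall hbound)

theorem relEuclideanConst_le (k : ℕ) :
    relEuclideanConst k X ≤
      2 * ⨆ (a : EllTwo (Fin k) ℝ →L[ℝ] EllTwo (Fin k) ℝ) (_ : ‖a‖ ≤ 1), tensorIdNorm X a := by
  set D := ⨆ (a : EllTwo (Fin k) ℝ →L[ℝ] EllTwo (Fin k) ℝ) (_ : ‖a‖ ≤ 1), tensorIdNorm X a
    with hD
  rcases eq_or_ne D ⊤ with h | h
  · rw [h, ENNReal.mul_top two_ne_zero]; exact le_top
  · refine iSup_le fun u => iSup₂_le fun hu hrank => ?_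
    have h2 := tensorIdNorm_le_of_rank_eq (X := X) (k := k) (d := D.toReal) ENNReal.toReal_nonneg
      (fun a ha => by rw [ENNReal.ofReal_toReal h]; exact le_iSup₂ (f := fun a (_ : ‖a‖ ≤ 1) => tensorIdNorm X a) a ha)
      hu.le hrank
    rwa [ENNReal.ofReal_mul two_pos.le, ENNReal.ofReal_toReal h, ENNReal.ofReal_ofNat] at h2

/-! ### Comparison with Euclidean distances of subspaces -/

/-- The squared norm splits over the coordinates `p` of `ℓ²(κ)`, and `a` acts on each one as a
scalar contraction. -/
theorem sum_norm_sq_sum_smul_le [Fintype ι] [DecidableEq ι] {κ : Type*} [Fintype κ]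
    {a : EllTwo ι ℝ →L[ℝ] EllTwo ι ℝ} (ha : ‖a‖ ≤ 1) (t : ι → EllTwo κ ℝ) :
    ∑ j, ‖∑ l, a (EllTwo.unit l) j • t l‖ ^ 2 ≤ ∑ l, ‖t l‖ ^ 2 := by
  simp only [EllTwo.norm_sq_eq_sum]
  rw [Finset.sum_comm, Finset.sum_comm (γ := ι)]
  refine Finset.sum_le_sum fun p _ => ?_
  set v : EllTwo ι ℝ := EllTwo.ofFun fun l => t l p
  have hv : ∀ j, (∑ l, a (EllTwo.unit l) j • t l : EllTwo κ ℝ) p = a v j := fun j => by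
    have h := ((EllTwo.hasSum_smul_unit v).mapL a).mapL (lp.evalCLM ℝ (fun _ : ι => ℝ) 2 j)
    have h' := h.unique (hasSum_fintype _)
    rw [lp.coeFn_sum, Finset.sum_apply]
    refine Eq.trans ?_ h'.symm
    refine Finset.sum_congr rfl fun l _ => ?_
    simp [lp.evalCLM, v, mul_comm]
  simp only [hv]
  rw [← EllTwo.norm_sq_eq_sum]
  have hvp : ∑ l, ‖t l p‖ ^ 2 = ‖v‖ ^ 2 := by rw [EllTwo.norm_sq_eq_sum]; rfl
  rw [hvp]
  exact pow_le_pow_left₀ (norm_nonneg _)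
    ((a.le_of_opNorm_le ha v).trans_eq (one_mul _)) 2

/-- Transport the span of the entries of `x` to Hilbert space by `T`, apply `a` there, and return by
`T.symm`. -/
theorem tensorIdNorm_le_euclideanDistConst {k : ℕ}
    {a : EllTwo (Fin k) ℝ →L[ℝ] EllTwo (Fin k) ℝ} (ha : ‖a‖ ≤ 1) :
    tensorIdNorm X a ≤ euclideanDistConst k X := by
  refine iSup₂_le fun z hz => ?_
  set x := tensorToEllTwo (Fin k) X z with hx
  set E : Submodule ℝ X := Submodule.span ℝ (Set.range x) with hE
  have hfin : FiniteDimensional ℝ E := FiniteDimensional.span_of_finite ℝ (Set.finite_range _)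
  have hdim : Module.finrank ℝ E ≤ k := (finrank_range_le_card _).trans_eq (Fintype.card_fin k)
  refine le_trans ?_ (le_iSup_of_le E (le_iSup₂_of_le hfin hdim le_rfl))
  refine le_iInf fun T => ?_
  set y : Fin k → E := fun l => ⟨x l, Submodule.subset_span ⟨l, rfl⟩⟩
  have hy : ∀ l, (y l : X) = x l := fun l => rfl
  simp only [← ofReal_norm]
  rw [← ENNReal.ofReal_mul (norm_nonneg _)]
  refine ENNReal.ofReal_le_ofReal ?_
  rw [← sq_le_sq₀ (norm_nonneg _) (by positivity), EllTwo.norm_sq_eq_sum]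
  simp only [tensorToEllTwo_rTensor_apply, ← hx]
  have h1 : ∀ j, ‖∑ l, a (EllTwo.unit l) j • x l‖ ^ 2 ≤
      ‖(T.symm : EllTwo (Fin (Module.finrank ℝ E)) ℝ →L[ℝ] E)‖ ^ 2 * ‖∑ l, a (EllTwo.unit l) j • T (y l)‖ ^ 2 := fun j => by
    rw [← mul_pow]
    refine pow_le_pow_left₀ (norm_nonneg _) ?_ 2
    have hle := (T.symm : EllTwo (Fin (Module.finrank ℝ E)) ℝ →L[ℝ] E).le_opNorm (∑ l, a (EllTwo.unit l) j • T (y l))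
    have hsymm : (T.symm : EllTwo (Fin (Module.finrank ℝ E)) ℝ →L[ℝ] E) (∑ l, a (EllTwo.unit l) j • T (y l)) =
        ∑ l, a (EllTwo.unit l) j • y l := by simp
    have hcoe : ((∑ l, a (EllTwo.unit l) j • y l : E) : X) = ∑ l, a (EllTwo.unit l) j • x l := by
      simp [hy]
    rw [hsymm] at hle
    rw [← hcoe]
    exact hle
  have h2 : ∑ l, ‖T (y l)‖ ^ 2 ≤ ‖(T : E →L[ℝ] EllTwo (Fin (Module.finrank ℝ E)) ℝ)‖ ^ 2 * ∑ l, ‖x l‖ ^ 2 := by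
    rw [Finset.mul_sum]
    refine Finset.sum_le_sum fun l _ => ?_
    rw [← mul_pow]
    exact pow_le_pow_left₀ (norm_nonneg _) ((T : E →L[ℝ] EllTwo (Fin (Module.finrank ℝ E)) ℝ).le_opNorm (y l)) 2
  have h3 : ∑ l, ‖x l‖ ^ 2 ≤ 1 := by
    rw [← EllTwo.norm_sq_eq_sum]; exact pow_le_one₀ (norm_nonneg _) hz
  calc _ ≤ ∑ j, ‖(T.symm : EllTwo (Fin (Module.finrank ℝ E)) ℝ →L[ℝ] E)‖ ^ 2 * ‖∑ l, a (EllTwo.unit l) j • T (y l)‖ ^ 2 :=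
        Finset.sum_le_sum fun j _ => h1 j
    _ ≤ ‖(T.symm : EllTwo (Fin (Module.finrank ℝ E)) ℝ →L[ℝ] E)‖ ^ 2 * (‖(T : E →L[ℝ] EllTwo (Fin (Module.finrank ℝ E)) ℝ)‖ ^ 2 * 1) := by
        rw [← Finset.mul_sum]
        exact mul_le_mul_of_nonneg_left (((sum_norm_sq_sum_smul_le ha _).trans h2).trans
          (mul_le_mul_of_nonneg_left h3 (sq_nonneg _))) (sq_nonneg _)
    _ = _ := by ring

end EllTwo

theorem theorem5p2 (X : Type*) [NormedAddCommGroup X] [NormedSpace ℝ X] [CompleteSpace X]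
    (k : ℕ) :
    relEuclideanConst k X ≤
        2 * (⨆ (a : EllTwo (Fin k) ℝ →L[ℝ] EllTwo (Fin k) ℝ) (_ : ‖a‖ ≤ 1), tensorIdNorm X a) ∧
      relEuclideanConst k X ≤ 2 * euclideanDistConst k X := by
  refine ⟨relEuclideanConst_le k, (relEuclideanConst_le k).trans ?_⟩
  gcongr
  exact iSup₂_le fun a ha => tensorIdNorm_le_euclideanDistConst ha
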